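/- Let $\ell_1$ be the real Banach space of absolutely summable sequences, let $X=(\ell_1,w)$ be $\ell_1$ equipped with its weak topology, and let $(e_n)$ be the canonical unit vector sequence. Conventions. All spaces are real. In a topological vector space $Y$ with dual $Y^*$: a sequence $(x_n)$ is *weakly Cauchy* if $(\varphi(x_n))_n$ is a Cauchy sequence for every $\varphi\in Y^*$; it is an *$\ell_1$-sequence* if the linear map $(a_i)\mapsto\sum_i a_i x_i$, defined on the subspace of finitely supported elements of $\ell_1$ with the $\ell_1$-norm, is an isomorphism of topological vector spaces onto its range. A set $C\subset Y$ has the *weak-AFPP* (weak approximate fixed point property) if for every continuous $f:C\to C$ there is a sequence $(x_n)$ in $C$ such that $\varphi(x_n-f(x_n))\to 0$ for every $\varphi\in Y^*$; the space $Y$ has the weak-AFPP if each of its nonempty bounded closed convex subsets has it. (In $Y=X$ the topology used for "continuous", "closed", "bounded" and "isomorphism" is the weak topology of $\ell_1$.) Then $X$ is a non-metrizable Hausdorff locally convex space, $(e_n)$ is bounded in $X$, and: (i) $(e_n)$ contains neither a weakly Cauchy subsequence nor a subsequence which is an $\ell_1$-sequence in $X$. (ii) $X$ contains no $\ell_1$-sequence,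 but $X$ does not have the weak-AFPP. Consequently, neither of the following two assertions holds for all Hausdorff locally convex spaces $Y$: (a) every bounded sequence in $Y$ has a subsequence that is weakly Cauchy or an $\ell_1$-sequence; (b) whenever $C\subset Y$ is nonempty, closed, convex and bounded and contains no $\ell_1$-sequence, every nonempty closed convex subset of $C$ has the weak-AFPP. -/

import Mathlib

open Filter Topology

noncomputable section

/-- The real Banach space `ℓ₁` of absolutely summable sequences, with its norm. -/
abbrev EllOne : Type := lp (fun _ : ℕ => ℝ) 1

/-- The subspace of `ℓ₁` formed by the elements with only finitely many nonzero coordinates,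
with the topology of the `ℓ₁`-norm. -/
def ellOneFin : Submodule ℝ EllOne where
  carrier := {a | (Function.support fun i => a i).Finite}
  zero_mem' := by simp
  add_mem' := by
    intro a b ha hb
    refine (Set.Finite.union ha hb).subset ?_
    exact Function.support_add (fun i => a i) (fun i => b i)
  smul_mem' := by
    intro c a ha
    refine Set.Finite.subset ha ?_
    exact Function.support_const_smul_subset c (fun i => a i)

theorem ellOneFin_smul_support_finite {X : Type*} [AddCommGroup X] [Module ℝ X]
    (x : ℕ → X) (a : ellOneFin) :
    (Function.support fun i => (a : EllOne) i • x i).Finite :=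
  Set.Finite.subset a.2 (Function.support_smul_subset_left (fun i => (a : EllOne) i) x)

/-- The linear map `(aᵢ) ↦ ∑ aᵢ xᵢ` on the finitely supported elements of `ℓ₁`
(each sum is finite). -/
def ellOneFinMap {X : Type*} [AddCommGroup X] [Module ℝ X] (x : ℕ → X) : ellOneFin →ₗ[ℝ] X where
  toFun a := ∑ᶠ i, (a : EllOne) i • x i
  map_add' a b := by
    rw [← finsum_add_distrib (ellOneFin_smul_support_finite x a)
      (ellOneFin_smul_support_finite x b)]
    exact finsum_congr fun i => add_smul _ _ _
  map_smul' c a := by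
    rw [RingHom.id_apply, smul_finsum' c (ellOneFin_smul_support_finite x a)]
    exact finsum_congr fun i => mul_smul _ _ _

/-- A sequence `x` in a topological vector space is an `ℓ₁`-sequence if the linear map
`(aᵢ) ↦ ∑ aᵢ xᵢ` is an isomorphism (linear homeomorphism) of the finitely supported elements
of `ℓ₁` onto its range. -/
def IsEllOneSequence {X : Type*} [AddCommGroup X] [Module ℝ X] [TopologicalSpace X]
    (x : ℕ → X) : Prop :=
  IsEmbedding (ellOneFinMap x)

/-- A sequence is weakly Cauchy if every continuous linear functional maps it to a Cauchy
sequence of reals. -/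
def IsWeaklyCauchy {X : Type*} [AddCommGroup X] [Module ℝ X] [TopologicalSpace X]
    (x : ℕ → X) : Prop :=
  ∀ φ : StrongDual ℝ X, CauchySeq fun n => φ (x n)

/-- `C` has the `σ(X, Z)`-approximate fixed point property: each continuous self-map `f` of `C`
admits a sequence `x` in `C` with `φ (x n - f (x n)) → 0` for all `φ ∈ Z`. -/
def SetHasAFPP {X : Type*} [AddCommGroup X] [Module ℝ X] [TopologicalSpace X]
    [IsTopologicalAddGroup X] [ContinuousSMul ℝ X]
    (Z : Submodule ℝ (StrongDual ℝ X)) (C : Set X) : Prop :=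
  ∀ f : C → C, Continuous f →
    ∃ x : ℕ → C, ∀ φ ∈ Z, Tendsto (fun n => φ ((x n : X) - (f (x n) : X))) atTop (𝓝 0)

/-- `X` has the `σ(X, Z)`-approximate fixed point property: every nonempty bounded closed convex
subset has it. -/
def HasAFPP (X : Type*) [AddCommGroup X] [Module ℝ X] [TopologicalSpace X]
    [IsTopologicalAddGroup X] [ContinuousSMul ℝ X]
    (Z : Submodule ℝ (StrongDual ℝ X)) : Prop :=
  ∀ C : Set X, C.Nonempty → Bornology.IsVonNBounded ℝ C → IsClosed C → Convex ℝ C →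
    SetHasAFPP Z C

/-- The weak approximate fixed point property of a set: the case `Z = X*`. -/
abbrev SetHasWeakAFPP {X : Type*} [AddCommGroup X] [Module ℝ X] [TopologicalSpace X]
    [IsTopologicalAddGroup X] [ContinuousSMul ℝ X] (C : Set X) : Prop :=
  SetHasAFPP (⊤ : Submodule ℝ (StrongDual ℝ X)) C

/-- The weak approximate fixed point property of a space: the case `Z = X*`. -/
abbrev HasWeakAFPP (X : Type*) [AddCommGroup X] [Module ℝ X] [TopologicalSpace X]
    [IsTopologicalAddGroup X] [ContinuousSMul ℝ X] : Prop :=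
  HasAFPP X (⊤ : Submodule ℝ (StrongDual ℝ X))

/-- The space `ℓ₁` equipped with its weak topology. -/
abbrev EllOneWeak : Type := WeakSpace ℝ EllOne

/-- The canonical basic sequence, regarded in `ℓ₁` with the weak topology. -/
def ellOneBasis (n : ℕ) : EllOneWeak := toWeakSpace ℝ EllOne (lp.single 1 n (1 : ℝ))

end

/-!
The weak topology of an infinite-dimensional normed space is much coarser than any norm: each
weak neighbourhood of zero contains whole lines of every infinite-dimensional subspace
(`WeakSpace.exists_ne_zero_forall_smul_mem`). Hence no linear map from the finitely supported
elements of `ℓ₁` into a weak space is an embedding (`not_isEllOneSequence_weakSpace`), and the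
weak topology is not metrizable: a countable base at zero would yield a weakly null sequence `xₙ`
with `‖xₙ‖ = n`, against the uniform boundedness principle (`WeakSpace.not_metrizableSpace`). A
subsequence of the unit vectors is not weakly Cauchy, since a functional with coefficients `±1`
alternates along it (`not_isWeaklyCauchy_ellOneBasis_comp`).

The weak approximate fixed point property fails on the face `C` (`positiveFace`) of nonnegative
sequences with sum `1`. The total mass is constant on `C`, so tails are small on weak
neighbourhoods, and the functions `(xₙ - 1/4)⁺` are locally finite on `C` in the weak topology.
Let `γ` (`basisRay`) be the polygonal ray `[0, ∞) → C` through `e₀, e₁, e₂, …`, and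
let `g` (`raySpeedUp`) be `3` plus the barycentre of the indices `n` with the weights
`(xₙ - 1/4)⁺`, truncated so as to be continuous where all weights vanish. The map `γ ∘ g`
(`rayMap`) is a weakly continuous self-map of `C`. If all coordinates of `x - γ (g x)` were
smaller than `1/8` in absolute value, with `g x ∈ [k, k + 1)`, then only the weights with indices
`k` and `k + 1` could be nonzero, and their sum would be at least `1/8`; the barycentre would be
at least `k`, whence `g x ≥ k + 3`, a contradiction. So `‖x - γ (g x)‖ ≥ 1/8` on `C`
(`exists_le_abs_weakCoord_sub_rayMap`), and by the Schur property of `ℓ₁`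
(`EllOne.tendsto_norm_zero_of_weak`) no sequence `xₙ - γ (g xₙ)` is weakly null.
-/

/-! ### Neighbourhoods of zero in weak topologies -/

/-- The finitely many functionals that define a weak neighbourhood of zero have a common zero
`a ≠ 0` on an infinite-dimensional space. -/
theorem WeakSpace.exists_ne_zero_forall_smul_mem {E M : Type*} [NormedAddCommGroup E]
    [NormedSpace ℝ E] [AddCommGroup M] [Module ℝ M] (hM : ¬ FiniteDimensional ℝ M)
    (T : M →ₗ[ℝ] WeakSpace ℝ E) {V : Set (WeakSpace ℝ E)} (hV : V ∈ 𝓝 0) :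
    ∃ a : M, a ≠ 0 ∧ ∀ c : ℝ, T (c • a) ∈ V := by
  obtain ⟨U, hU, hUV⟩ := ((topDualPairing ℝ E).flip.hasBasis_weakBilin).mem_iff.1 hV
  obtain ⟨s, r, hr, rfl⟩ := (SeminormFamily.basisSets_iff _).1 hU
  let L : M →ₗ[ℝ] (s → ℝ) := LinearMap.pi fun φ =>
    (φ.1 : E →ₗ[ℝ] ℝ) ∘ₗ (toWeakSpace ℝ E).symm.toLinearMap ∘ₗ T
  have hL : ¬ Function.Injective L := fun h => hM (Module.Finite.of_injective L h)
  rw [← LinearMap.ker_eq_bot, Submodule.eq_bot_iff] at hL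
  push Not at hL
  obtain ⟨a, ha, ha0⟩ := hL
  refine ⟨a, ha0, fun c => hUV ?_⟩
  refine (Seminorm.mem_ball_zero _).2 ?_
  refine Seminorm.finset_sup_apply_lt hr fun φ hφ => ?_
  have h1 : L (c • a) ⟨φ, hφ⟩ = 0 := by
    rw [map_smul, LinearMap.mem_ker.1 ha, smul_zero, Pi.zero_apply]
  change ‖L (c • a) ⟨φ, hφ⟩‖ < r
  rw [h1, norm_zero]
  exact hr

/-- The functional `φ` as a continuous functional on `E` with its weak topology. -/
noncomputable def weakFunctional {E : Type*} [NormedAddCommGroup E] [NormedSpace ℝ E]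
    (φ : E →L[ℝ] ℝ) : StrongDual ℝ (WeakSpace ℝ E) :=
  WeakBilin.eval (topDualPairing ℝ E).flip φ

/-- With a countable base at zero, neighbourhoods containing lines would yield a weakly null
sequence with `‖xₙ‖ = n`, contradicting the uniform boundedness principle. -/
theorem WeakSpace.not_metrizableSpace {E : Type*} [NormedAddCommGroup E] [NormedSpace ℝ E]
    (hE : ¬ FiniteDimensional ℝ E) : ¬ TopologicalSpace.MetrizableSpace (WeakSpace ℝ E) := by
  intro _
  obtain ⟨V, hV⟩ := (𝓝 (0 : WeakSpace ℝ E)).exists_antitone_basis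
  have hex : ∀ n : ℕ, ∃ x : E, ‖x‖ = n ∧ toWeakSpace ℝ E x ∈ V n := fun n => by
    obtain ⟨a, ha, haV⟩ := WeakSpace.exists_ne_zero_forall_smul_mem hE
      (toWeakSpace ℝ E).toLinearMap (hV.1.mem_of_mem (i := n) trivial)
    refine ⟨(n * ‖a‖⁻¹ : ℝ) • a, ?_, haV _⟩
    have : ‖a‖ ≠ 0 := norm_ne_zero_iff.2 ha
    rw [norm_smul, Real.norm_of_nonneg (by positivity)]
    field_simp
  choose x hx hxV using hex
  have hlim : Tendsto (fun n => toWeakSpace ℝ E (x n)) atTop (𝓝 0) := hV.tendsto hxV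
  obtain ⟨C, hC⟩ := banach_steinhaus (g := fun n => NormedSpace.inclusionInDoubleDual ℝ E (x n))
    fun φ => by
      have h : Tendsto (fun n => φ (x n)) atTop (𝓝 0) := by
        have h0 := ((weakFunctional φ).continuous.tendsto 0).comp hlim
        rw [map_zero] at h0
        exact h0
      obtain ⟨C, hC⟩ := (Metric.isBounded_range_of_tendsto _ h).exists_norm_le
      exact ⟨C, fun n => hC _ ⟨n, rfl⟩⟩
  obtain ⟨n, hn⟩ := exists_nat_gt C
  have h1 : ‖NormedSpace.inclusionInDoubleDual ℝ E (x n)‖ = ‖x n‖ :=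
    (NormedSpace.inclusionInDoubleDualLi ℝ).norm_map (x n)
  have := hC n
  rw [h1, hx] at this
  linarith


theorem EllOneWeak.locallyConvexSpace : LocallyConvexSpace ℝ EllOneWeak :=
  inferInstanceAs (LocallyConvexSpace ℝ (WeakBilin (topDualPairing ℝ EllOne).flip))

/-! ### Functionals on `ℓ₁` and the Schur property -/

theorem EllOne.summable_norm (x : EllOne) : Summable fun i => |x i| := by
  simpa using (lp.memℓp x).summable (by simp)

theorem EllOne.norm_eq_tsum (x : EllOne) : ‖x‖ = ∑' i, |x i| := by
  simpa using lp.norm_eq_tsum_rpow (by simp) x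

theorem EllOne.summable_mul {b : ℕ → ℝ} (hb : ∀ i, |b i| ≤ 1) (x : EllOne) :
    Summable fun i => b i * x i :=
  Summable.of_norm_bounded x.summable_norm fun i => by
    rw [Real.norm_eq_abs, abs_mul]
    exact mul_le_of_le_one_left (abs_nonneg _) (hb i)

/-- The functional `x ↦ ∑ bᵢ xᵢ` on `ℓ₁` given by an element `b` of the unit ball of `ℓ_∞`. -/
noncomputable def EllOne.functional (b : ℕ → ℝ) (hb : ∀ i, |b i| ≤ 1) : EllOne →L[ℝ] ℝ :=
  LinearMap.mkContinuous
    { toFun := fun x => ∑' i, b i * x i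
      map_add' := fun x y => by
        rw [← (x.summable_mul hb).tsum_add (y.summable_mul hb)]
        exact tsum_congr fun i => mul_add _ _ _
      map_smul' := fun c x => by
        rw [RingHom.id_apply, smul_eq_mul, ← tsum_mul_left]
        exact tsum_congr fun i => mul_left_comm _ _ _ }
    1 fun x => by
      rw [one_mul, EllOne.norm_eq_tsum]
      refine tsum_of_norm_bounded x.summable_norm.hasSum fun i => ?_
      rw [Real.norm_eq_abs, abs_mul]
      exact mul_le_of_le_one_left (abs_nonneg _) (hb i)

theorem EllOne.functional_apply (b : ℕ → ℝ) (hb : ∀ i, |b i| ≤ 1) (x : EllOne) :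
    EllOne.functional b hb x = ∑' i, b i * x i := rfl

theorem EllOne.functional_single (b : ℕ → ℝ) (hb : ∀ i, |b i| ≤ 1) (n : ℕ) :
    EllOne.functional b hb (lp.single 1 n (1 : ℝ)) = b n := by
  rw [EllOne.functional_apply, tsum_eq_single n]
  · simp
  · intro i hi
    simp [hi]

/-- The real sign `±1` attached to a Boolean. -/
noncomputable def boolSign (s : Bool) : ℝ := if s then 1 else -1

theorem abs_boolSign (s : Bool) : |boolSign s| = 1 := by
  cases s <;> simp [boolSign]

theorem boolSign_decide_mul (t : ℝ) : boolSign (decide (0 ≤ t)) * t = |t| := by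
  by_cases h : 0 ≤ t
  · simp [boolSign, h, abs_of_nonneg]
  · simp [boolSign, h, abs_of_neg (not_le.1 h)]

/-- The Schur property of `ℓ₁`: weakly null sequences are norm null. By the Baire property of the
compact space of sign sequences, some basic open set of signs `s` satisfies
`|∑ sᵢ xₙ(i)| ≤ ε / 2` for all large `n` uniformly; outside a finite set of coordinates these signs
can be chosen to match those of `xₙ`. -/
theorem EllOne.tendsto_norm_zero_of_weak {x : ℕ → EllOne}
    (hx : ∀ φ : EllOne →L[ℝ] ℝ, Tendsto (fun n => φ (x n)) atTop (𝓝 0)) :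
    Tendsto (fun n => ‖x n‖) atTop (𝓝 0) := by
  have hcoord : ∀ i, Tendsto (fun n => x n i) atTop (𝓝 0) := fun i => hx (lp.evalCLM ℝ _ 1 i)
  let P : (ℕ → Bool) → ℕ → ℝ := fun s n => ∑' i, boolSign (s i) * x n i
  have hPc : ∀ n, Continuous fun s => P s n := fun n => by
    refine continuous_tsum (fun i => ?_) (x n).summable_norm fun i s => ?_
    · exact ((continuous_of_discreteTopology (f := boolSign)).comp (continuous_apply i)).mul
        continuous_const
    · rw [Real.norm_eq_abs, abs_mul, abs_boolSign, one_mul]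
  rw [Metric.tendsto_atTop]
  intro ε hε
  let F : ℕ → Set (ℕ → Bool) := fun m => ⋂ n ≥ m, {s | |P s n| ≤ ε / 2}
  have hFc : ∀ m, IsClosed (F m) := fun m =>
    isClosed_biInter fun n _ => isClosed_le (hPc n).abs continuous_const
  have hFU : ⋃ m, F m = Set.univ := by
    refine Set.eq_univ_of_forall fun s => Set.mem_iUnion.2 ?_
    have h := Metric.tendsto_atTop.1
      (hx (EllOne.functional (fun i => boolSign (s i)) fun i => (abs_boolSign _).le)) (ε / 2)
      (by positivity)
    obtain ⟨m, hm⟩ := h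
    refine ⟨m, Set.mem_iInter₂.2 fun n hn => ?_⟩
    have := hm n hn
    rw [Real.dist_0_eq_abs] at this
    exact this.le
  obtain ⟨m, s, hs⟩ := nonempty_interior_of_iUnion_of_closed hFc hFU
  obtain ⟨I, u, hu, hIu⟩ := isOpen_pi_iff.1 isOpen_interior s hs
  have hlim : Tendsto (fun n => ∑ i ∈ I, 2 * |x n i|) atTop (𝓝 0) := by
    have : Tendsto (fun n => ∑ i ∈ I, 2 * |x n i|) atTop (𝓝 (∑ i ∈ I, 2 * |(0 : ℝ)|)) :=
      tendsto_finsetSum _ fun i _ => (hcoord i).abs.const_mul 2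
    simpa using this
  obtain ⟨m', hm'⟩ := Metric.tendsto_atTop.1 hlim (ε / 2) (by positivity)
  refine ⟨max m m', fun n hn => ?_⟩
  have h1 := hm' n (le_of_max_le_right hn)
  rw [Real.dist_0_eq_abs] at h1
  rw [Real.dist_0_eq_abs, abs_norm, EllOne.norm_eq_tsum]
  -- change the signs `s` outside `I` to those of `x n`; this does not leave `F m`
  let s' : ℕ → Bool := fun i => if i ∈ I then s i else decide (0 ≤ x n i)
  have hs' : s' ∈ F m := interior_subset <| hIu fun i hi => by
    simp only [s', if_pos (Finset.mem_coe.1 hi)]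
    exact (hu i hi).2
  have h2 : |P s' n| ≤ ε / 2 := Set.mem_iInter₂.1 hs' n (le_of_max_le_left hn)
  have hsum := (x n).summable_mul (b := fun i => boolSign (s' i)) fun i => (abs_boolSign _).le
  have h3 : ∑' i, |x n i| - P s' n = ∑ i ∈ I, (|x n i| - boolSign (s' i) * x n i) := by
    rw [← (x n).summable_norm.tsum_sub hsum]
    refine tsum_eq_sum fun i hi => ?_
    simp only [s', if_neg hi, boolSign_decide_mul, sub_self]
  have h4 : ∑ i ∈ I, (|x n i| - boolSign (s' i) * x n i) ≤ ∑ i ∈ I, 2 * |x n i| := by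
    refine Finset.sum_le_sum fun i _ => ?_
    have : |boolSign (s' i) * x n i| = |x n i| := by rw [abs_mul, abs_boolSign, one_mul]
    linarith [neg_abs_le (boolSign (s' i) * x n i)]
  linarith [le_abs_self (P s' n), le_abs_self (∑ i ∈ I, 2 * |x n i|)]

/-! ### No `ℓ₁`-sequences and no weakly Cauchy subsequence of the basis -/

theorem not_finiteDimensional_ellOneFin : ¬ FiniteDimensional ℝ ellOneFin := by
  intro _
  have hmem : ∀ n : ℕ, (lp.single 1 n (1 : ℝ) : EllOne) ∈ ellOneFin := fun n => by
    refine (Set.finite_singleton n).subset fun i hi => ?_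
    by_contra h
    exact hi (lp.single_apply_ne (E := fun _ : ℕ => ℝ) 1 n (1 : ℝ) h)
  let v : ℕ → ellOneFin := fun n => ⟨lp.single 1 n (1 : ℝ), hmem n⟩
  have hv : LinearIndependent ℝ v := by
    rw [linearIndependent_iff']
    intro s g hg i hi
    let c : ellOneFin →ₗ[ℝ] ℝ := (lp.evalCLM ℝ (fun _ : ℕ => ℝ) 1 i).toLinearMap ∘ₗ
      ellOneFin.subtype
    have hc : ∀ j, c (v j) = if j = i then 1 else 0 := fun j => by
      change (lp.single 1 j (1 : ℝ) : EllOne) i = _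
      by_cases h : j = i
      · subst h; simp
      · simp [h, Ne.symm h]
    have h := congrArg c hg
    simpa [hc, hi] using h
  exact Module.Finite.not_linearIndependent_of_infinite v hv

theorem not_finiteDimensional_ellOne : ¬ FiniteDimensional ℝ EllOne := fun _ =>
  not_finiteDimensional_ellOneFin inferInstance

/-- A weak neighbourhood of zero contains whole lines of any infinite-dimensional subspace, so
the weak topology of a subspace is never given by a norm. -/
theorem not_isEllOneSequence_weakSpace {E : Type*} [NormedAddCommGroup E] [NormedSpace ℝ E]
    (x : ℕ → WeakSpace ℝ E) : ¬ IsEllOneSequence x := by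
  intro h
  have hU : Metric.ball (0 : ellOneFin) 1 ∈ 𝓝 0 := Metric.ball_mem_nhds _ one_pos
  rw [h.nhds_eq_comap, map_zero] at hU
  obtain ⟨V, hV, hVU⟩ := hU
  obtain ⟨a, ha, haV⟩ := WeakSpace.exists_ne_zero_forall_smul_mem
    not_finiteDimensional_ellOneFin (ellOneFinMap x) hV
  have h1 := hVU (haV ‖a‖⁻¹)
  rw [mem_ball_zero_iff, norm_smul, norm_inv, norm_norm,
    inv_mul_cancel₀ (norm_ne_zero_iff.2 ha)] at h1
  exact lt_irrefl _ h1

theorem not_isWeaklyCauchy_ellOneBasis_comp {k : ℕ → ℕ} (hk : StrictMono k) :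
    ¬ IsWeaklyCauchy (ellOneBasis ∘ k) := by
  classical
  intro h
  -- the functional alternates between `1` and `-1` along the subsequence
  let b : ℕ → ℝ := fun i => if ∃ j, i = k (2 * j) then 1 else -1
  have hb : ∀ i, |b i| ≤ 1 := fun i => by
    by_cases hi : ∃ j, i = k (2 * j)
    · simp only [b, if_pos hi, abs_one, le_refl]
    · simp only [b, if_neg hi, abs_neg, abs_one, le_refl]
  have hval : ∀ j, weakFunctional (EllOne.functional b hb) ((ellOneBasis ∘ k) j) = b (k j) :=
    fun j => EllOne.functional_single b hb (k j)
  have hc := h (weakFunctional (EllOne.functional b hb))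
  simp only [hval] at hc
  obtain ⟨N, hN⟩ := Metric.cauchySeq_iff.1 hc 1 one_pos
  have h1 := hN (2 * N) (by omega) (2 * N + 1) (by omega)
  have e1 : b (k (2 * N)) = 1 := if_pos ⟨N, rfl⟩
  have e2 : b (k (2 * N + 1)) = -1 := if_neg fun ⟨j, hj⟩ => by
    have := hk.injective hj
    omega
  rw [e1, e2, Real.dist_eq] at h1
  norm_num at h1

/-! ### The positive face of the unit sphere -/

/-- The `n`-th coordinate, as a weakly continuous functional. -/
noncomputable def weakCoord (n : ℕ) : StrongDual ℝ EllOneWeak :=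
  weakFunctional (lp.evalCLM ℝ (fun _ : ℕ => ℝ) 1 n)

/-- The sum of all coordinates, as a weakly continuous functional. -/
noncomputable def weakTotal : StrongDual ℝ EllOneWeak :=
  weakFunctional (EllOne.functional (fun _ => 1) fun _ => by simp)

theorem weakCoord_ellOneBasis (n m : ℕ) :
    weakCoord n (ellOneBasis m) = if n = m then 1 else 0 := by
  change (lp.single 1 m (1 : ℝ) : EllOne) n = _
  by_cases h : n = m
  · subst h; simp
  · simp [h]

theorem weakTotal_ellOneBasis (n : ℕ) : weakTotal (ellOneBasis n) = 1 :=
  EllOne.functional_single (fun _ => 1) (fun _ => by simp) n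

theorem hasSum_weakCoord (x : EllOneWeak) : HasSum (fun n => weakCoord n x) (weakTotal x) := by
  have h := (((toWeakSpace ℝ EllOne).symm x).summable_mul (b := fun _ => 1) (by simp)).hasSum
  have e : (fun n => weakCoord n x) =
      fun n => 1 * ((toWeakSpace ℝ EllOne).symm x : EllOne) n := by
    funext n
    rw [one_mul]
    rfl
  rw [e]
  exact h

/-- The positive face of the unit sphere of `ℓ₁`: nonnegative sequences with sum `1`. -/
def positiveFace : Set EllOneWeak :=
  {x | (∀ n, 0 ≤ weakCoord n x) ∧ weakTotal x = 1}

theorem ellOneBasis_mem_positiveFace (n : ℕ) : ellOneBasis n ∈ positiveFace :=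
  ⟨fun i => by rw [weakCoord_ellOneBasis]; split_ifs <;> norm_num, weakTotal_ellOneBasis n⟩

theorem isClosed_positiveFace : IsClosed positiveFace := by
  rw [positiveFace, Set.ofPred_and, Set.ofPred_forall]
  exact (isClosed_iInter fun n => isClosed_le continuous_const (weakCoord n).continuous).inter
    (isClosed_eq weakTotal.continuous continuous_const)

theorem convex_positiveFace : Convex ℝ positiveFace := by
  intro x hx y hy a b ha hb hab
  refine ⟨fun n => ?_, ?_⟩
  · simp only [map_add, map_smul, smul_eq_mul]
    exact add_nonneg (mul_nonneg ha (hx.1 n)) (mul_nonneg hb (hy.1 n))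
  · simp only [map_add, map_smul, smul_eq_mul, hx.2, hy.2, mul_one, hab]

theorem isVonNBounded_positiveFace : Bornology.IsVonNBounded ℝ positiveFace := by
  have hsub : positiveFace ⊆ toWeakSpaceCLM ℝ EllOne '' Metric.closedBall 0 1 := by
    intro x hx
    refine ⟨(toWeakSpace ℝ EllOne).symm x, ?_, rfl⟩
    rw [mem_closedBall_zero_iff, EllOne.norm_eq_tsum]
    have h : (fun n => |((toWeakSpace ℝ EllOne).symm x : EllOne) n|) = fun n => weakCoord n x :=
      funext fun n => abs_of_nonneg (hx.1 n)
    rw [h, (hasSum_weakCoord x).tsum_eq, hx.2]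
  exact ((NormedSpace.isVonNBounded_closedBall ℝ EllOne 1).image _).subset hsub

/-! ### The ray through the unit vectors -/

/-- The tent function of height `1` at `n` supported on `[n - 1, n + 1]`. -/
noncomputable def tent (n : ℕ) (t : ℝ) : ℝ := max (1 - |t - n|) 0

theorem continuous_tent (n : ℕ) : Continuous (tent n) := by
  unfold tent
  fun_prop

theorem locallyFinite_support_tent : LocallyFinite fun n => Function.support (tent n) := by
  intro t
  refine ⟨Metric.ball t 1, Metric.ball_mem_nhds t one_pos,
    (Set.finite_Iic ⌈t + 2⌉₊).subset ?_⟩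
  rintro n ⟨u, hu, hut⟩
  have h1 : 0 < 1 - |u - n| := by
    by_contra h
    exact hu (max_eq_right (not_lt.1 h))
  have h2 : |u - t| < 1 := hut
  have h3 : (n : ℝ) ≤ ⌈t + 2⌉₊ := by
    have := Nat.le_ceil (t + 2)
    have := abs_lt.1 h2
    have := abs_lt.1 (show |u - n| < 1 by linarith)
    linarith
  exact_mod_cast h3

theorem tent_eq_of_floor {t : ℝ} (ht : 0 ≤ t) (n : ℕ) :
    tent n t = if n = ⌊t⌋₊ then 1 - (t - ⌊t⌋₊) else if n = ⌊t⌋₊ + 1 then t - ⌊t⌋₊ else 0 := by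
  have h1 := Nat.floor_le ht
  have h2 := Nat.lt_floor_add_one t
  unfold tent
  split_ifs with h h'
  · rw [h, abs_of_nonneg (by linarith), max_eq_left (by linarith)]
  · rw [h']
    push_cast
    rw [abs_of_nonpos (by linarith), max_eq_left (by linarith)]
    ring
  · refine max_eq_right ?_
    rcases lt_or_gt_of_ne h with h3 | h3
    · have : (n : ℝ) + 1 ≤ ⌊t⌋₊ := by exact_mod_cast h3
      rw [abs_of_nonneg (by linarith)]
      linarith
    · have : (⌊t⌋₊ : ℝ) + 1 + 1 ≤ n := by exact_mod_cast (by omega : ⌊t⌋₊ + 1 + 1 ≤ n)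
      rw [abs_of_nonpos (by linarith)]
      linarith

/-- The polygonal ray through the vertices `e₀, e₁, e₂, …`, with `basisRay n = eₙ`. -/
noncomputable def basisRay (t : ℝ) : EllOneWeak := ∑ᶠ n, tent n t • ellOneBasis n

theorem continuous_basisRay : Continuous basisRay :=
  continuous_finsum (fun n => (continuous_tent n).smul continuous_const)
    (locallyFinite_support_tent.subset fun n t ht h => ht (by simp only [h, zero_smul]))

theorem basisRay_eq {t : ℝ} (ht : 0 ≤ t) :
    basisRay t = (1 - (t - ⌊t⌋₊)) • ellOneBasis ⌊t⌋₊ +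
      (t - ⌊t⌋₊) • ellOneBasis (⌊t⌋₊ + 1) := by
  rw [basisRay, finsum_eq_sum_of_support_subset (s := {⌊t⌋₊, ⌊t⌋₊ + 1})]
  · rw [Finset.sum_pair (by omega)]
    simp [tent_eq_of_floor ht]
  · intro n hn
    by_contra h
    simp only [Finset.coe_insert, Finset.coe_singleton, Set.mem_insert_iff,
      Set.mem_singleton_iff, not_or] at h
    refine hn ?_
    simp only [tent_eq_of_floor ht, if_neg h.1, if_neg h.2, zero_smul]

theorem basisRay_mem_positiveFace {t : ℝ} (ht : 0 ≤ t) : basisRay t ∈ positiveFace := by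
  rw [basisRay_eq ht]
  exact convex_positiveFace (ellOneBasis_mem_positiveFace _) (ellOneBasis_mem_positiveFace _)
    (by linarith [Nat.lt_floor_add_one t]) (by linarith [Nat.floor_le ht]) (by ring)

theorem weakCoord_basisRay {t : ℝ} (ht : 0 ≤ t) (n : ℕ) :
    weakCoord n (basisRay t) = tent n t := by
  rw [basisRay_eq ht, tent_eq_of_floor ht]
  simp only [map_add, map_smul, smul_eq_mul, weakCoord_ellOneBasis]
  split_ifs <;> first | omega | ring

/-! ### A self-map of the face without approximate fixed points -/

/-- The part of the `n`-th coordinate exceeding `1/4`. On `positiveFace`, locally in the weak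
topology, only finitely many of these functions are nonzero. -/
noncomputable def coordExcess (n : ℕ) (x : EllOneWeak) : ℝ := max (weakCoord n x - 1 / 4) 0

theorem coordExcess_nonneg (n : ℕ) (x : EllOneWeak) : 0 ≤ coordExcess n x := le_max_right _ _

theorem continuous_coordExcess (n : ℕ) : Continuous (coordExcess n) := by
  unfold coordExcess
  have := (weakCoord n).continuous
  fun_prop

/-- Almost all the mass of `x` sits on a finite set of coordinates, and so does that of all
weakly nearby points, since the total mass is constant on the face. -/
theorem locallyFinite_support_coordExcess :
    LocallyFinite fun n => Function.support fun x : positiveFace => coordExcess n x := by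
  intro x
  have hsum : HasSum (fun n => weakCoord n x) 1 := x.2.2 ▸ hasSum_weakCoord x.1
  obtain ⟨I, hI⟩ := ((tendsto_order.1 hsum).1 (3 / 4) (by norm_num)).exists
  refine ⟨{y | 3 / 4 < ∑ n ∈ I, weakCoord n y}, ?_, I.finite_toSet.subset ?_⟩
  · refine (isOpen_lt continuous_const ?_).mem_nhds hI
    exact continuous_finsetSum _ fun n _ => (weakCoord n).continuous.comp continuous_subtype_val
  · rintro n ⟨y, hy, hyI⟩
    by_contra hn
    refine hy (max_eq_right ?_)
    have h1 := sum_le_hasSum (insert n I) (fun i _ => y.2.1 i) (hasSum_weakCoord y.1)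
    rw [Finset.sum_insert hn, y.2.2] at h1
    have h2 : 3 / 4 < ∑ n ∈ I, weakCoord n y := hyI
    linarith

/-- A weakly continuous function with values at least `t + 2` near `basisRay t`: a truncated
barycentre of the indices of the large coordinates, increased by `3`. -/
noncomputable def raySpeedUp (x : positiveFace) : ℝ :=
  (∑ᶠ n : ℕ, (n : ℝ) * coordExcess n x) / max (∑ᶠ n, coordExcess n x) (1 / 8) + 3

theorem continuous_raySpeedUp : Continuous raySpeedUp := by
  have h (n : ℕ) : Continuous fun x : positiveFace => coordExcess n x :=
    (continuous_coordExcess n).comp continuous_subtype_val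
  refine Continuous.add (Continuous.div ?_ ?_ fun x => ?_) continuous_const
  · exact continuous_finsum (fun n => continuous_const.mul (h n))
      (locallyFinite_support_coordExcess.subset fun _ => Function.support_mul_subset_right _ _)
  · exact (continuous_finsum h locallyFinite_support_coordExcess).max continuous_const
  · exact (lt_max_of_lt_right (by norm_num)).ne'

theorem raySpeedUp_nonneg (x : positiveFace) : 0 ≤ raySpeedUp x := by
  refine add_nonneg (div_nonneg (finsum_nonneg fun n => ?_) ?_) (by norm_num)
  · exact mul_nonneg n.cast_nonneg (coordExcess_nonneg _ _)
  · exact le_max_of_le_right (by norm_num)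

/-- The self-map of the face that has no approximate fixed points. -/
noncomputable def rayMap (x : positiveFace) : positiveFace :=
  ⟨basisRay (raySpeedUp x), basisRay_mem_positiveFace (raySpeedUp_nonneg x)⟩

theorem continuous_rayMap : Continuous rayMap :=
  (continuous_basisRay.comp continuous_raySpeedUp).subtype_mk _

/-- If `x` were within `1/8` of its image `basisRay t` in all coordinates, its large coordinates
would have indices `⌊t⌋₊` and `⌊t⌋₊ + 1`, which forces `t = raySpeedUp x ≥ ⌊t⌋₊ + 3`. -/
theorem exists_le_abs_weakCoord_sub_rayMap (x : positiveFace) :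
    ∃ n, 1 / 8 ≤ |weakCoord n ((x : EllOneWeak) - rayMap x)| := by
  by_contra! hcon
  set t := raySpeedUp x with ht
  have ht0 : 0 ≤ t := raySpeedUp_nonneg x
  set k := ⌊t⌋₊ with hk
  have hclose : ∀ n, |weakCoord n x - tent n t| < 1 / 8 := fun n => by
    have := hcon n
    rwa [map_sub, show weakCoord n (rayMap x) = tent n t from weakCoord_basisRay ht0 n] at this
  -- near the point `basisRay t` only the coordinates `k` and `k + 1` can be large
  have hzero : ∀ n, n ≠ k → n ≠ k + 1 → coordExcess n x = 0 := fun n h1 h2 => by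
    have := hclose n
    rw [tent_eq_of_floor ht0, if_neg h1, if_neg h2] at this
    refine max_eq_right ?_
    linarith [(abs_lt.1 this).2]
  have hsupp : ∀ n, n ∉ ({k, k + 1} : Finset ℕ) → coordExcess n x = 0 := fun n hn => by
    simp only [Finset.mem_insert, Finset.mem_singleton, not_or] at hn
    exact hzero n hn.1 hn.2
  have hS : ∑ᶠ n, coordExcess n x = coordExcess k x + coordExcess (k + 1) x := by
    rw [finsum_eq_sum_of_support_subset (s := {k, k + 1}), Finset.sum_pair (by omega)]
    exact fun n hn => by_contra fun h => hn (hsupp n h)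
  have hN : ∑ᶠ n : ℕ, (n : ℝ) * coordExcess n x =
      k * coordExcess k x + (k + 1) * coordExcess (k + 1) x := by
    rw [finsum_eq_sum_of_support_subset (s := {k, k + 1}), Finset.sum_pair (by omega)]
    · push_cast
      rfl
    · exact fun n hn => by_contra fun h => hn (by simp only [hsupp n h, mul_zero])
  have h0 := coordExcess_nonneg k x
  have h1 := coordExcess_nonneg (k + 1) x
  -- one of the two coordinates of `basisRay t` is at least `1/2`
  have hlarge : 1 / 8 ≤ coordExcess k x + coordExcess (k + 1) x := by
    have e0 : weakCoord k x - 1 / 4 ≤ coordExcess k x := le_max_left _ _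
    have e1 : weakCoord (k + 1) x - 1 / 4 ≤ coordExcess (k + 1) x := le_max_left _ _
    have c0 := hclose k
    have c1 := hclose (k + 1)
    rw [tent_eq_of_floor ht0, if_pos rfl] at c0
    rw [tent_eq_of_floor ht0, if_neg (by omega), if_pos rfl] at c1
    have c0' := (abs_lt.1 c0).1
    have c1' := (abs_lt.1 c1).1
    rcases le_total (t - k) (1 / 2) with h | h <;> linarith
  have hfloor : t < k + 1 := Nat.lt_floor_add_one t
  have hval : t = (k * coordExcess k x + (k + 1) * coordExcess (k + 1) x) /
      (coordExcess k x + coordExcess (k + 1) x) + 3 := by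
    rw [ht, raySpeedUp, hS, hN, max_eq_left hlarge]
  have hge : (k : ℝ) ≤ (k * coordExcess k x + (k + 1) * coordExcess (k + 1) x) /
      (coordExcess k x + coordExcess (k + 1) x) := by
    rw [le_div_iff₀ (by linarith)]
    nlinarith
  linarith

theorem not_setHasWeakAFPP_positiveFace : ¬ SetHasWeakAFPP positiveFace := by
  intro h
  obtain ⟨x, hx⟩ := h rayMap continuous_rayMap
  let z : ℕ → EllOne := fun n =>
    (toWeakSpace ℝ EllOne).symm ((x n : EllOneWeak) - (rayMap (x n) : EllOneWeak))
  have hz : Tendsto (fun n => ‖z n‖) atTop (𝓝 0) :=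
    EllOne.tendsto_norm_zero_of_weak fun φ => hx (weakFunctional φ) trivial
  refine absurd (ge_of_tendsto' hz fun n => ?_) (show ¬ (1 / 8 : ℝ) ≤ 0 by norm_num)
  obtain ⟨i, hi⟩ := exists_le_abs_weakCoord_sub_rayMap (x n)
  exact hi.trans (lp.norm_apply_le_norm one_ne_zero (z n) i)

/-! ### The counterexample -/

theorem mainTheorem11 :
    -- the space is a non-metrizable Hausdorff locally convex space
    (T2Space EllOneWeak ∧ LocallyConvexSpace ℝ EllOneWeak ∧
      ¬ TopologicalSpace.MetrizableSpace EllOneWeak) ∧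
    -- (i) the (bounded) basis has no weakly Cauchy subsequence and no `ℓ₁`-subsequence
    (Bornology.IsVonNBounded ℝ (Set.range ellOneBasis) ∧
      (∀ k : ℕ → ℕ, StrictMono k → ¬ IsWeaklyCauchy (ellOneBasis ∘ k)) ∧
      (∀ k : ℕ → ℕ, StrictMono k → ¬ IsEllOneSequence (ellOneBasis ∘ k))) ∧
    -- (ii) no `ℓ₁`-sequence, but no weak approximate fixed point property
    ((∀ x : ℕ → EllOneWeak, ¬ IsEllOneSequence x) ∧ ¬ HasWeakAFPP EllOneWeak) ∧
    -- metrizability cannot be dropped in the dichotomy for bounded sequences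
    (¬ ∀ (Y : Type) [AddCommGroup Y] [Module ℝ Y] [TopologicalSpace Y]
        [IsTopologicalAddGroup Y] [ContinuousSMul ℝ Y] [LocallyConvexSpace ℝ Y] [T2Space Y]
        (x : ℕ → Y), Bornology.IsVonNBounded ℝ (Set.range x) →
        ∃ k : ℕ → ℕ, StrictMono k ∧ (IsWeaklyCauchy (x ∘ k) ∨ IsEllOneSequence (x ∘ k))) ∧
    -- nor in the theorem that sets without `ℓ₁`-sequences have the property hereditarily
    (¬ ∀ (Y : Type) [AddCommGroup Y] [Module ℝ Y] [TopologicalSpace Y]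
        [IsTopologicalAddGroup Y] [ContinuousSMul ℝ Y] [LocallyConvexSpace ℝ Y] [T2Space Y]
        (C : Set Y), C.Nonempty → IsClosed C → Convex ℝ C → Bornology.IsVonNBounded ℝ C →
        (∀ x : ℕ → Y, (∀ n, x n ∈ C) → ¬ IsEllOneSequence x) →
        ∀ D : Set Y, D ⊆ C → D.Nonempty → IsClosed D → Convex ℝ D → SetHasWeakAFPP D) := by
  have hbdd : Bornology.IsVonNBounded ℝ (Set.range ellOneBasis) :=
    isVonNBounded_positiveFace.subset <| Set.range_subset_iff.2 ellOneBasis_mem_positiveFace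
  have hne : positiveFace.Nonempty := ⟨_, ellOneBasis_mem_positiveFace 0⟩
  have := EllOneWeak.locallyConvexSpace
  refine ⟨⟨inferInstance, EllOneWeak.locallyConvexSpace,
      WeakSpace.not_metrizableSpace not_finiteDimensional_ellOne⟩,
    ⟨hbdd, fun k hk => not_isWeaklyCauchy_ellOneBasis_comp hk,
      fun k _ => not_isEllOneSequence_weakSpace _⟩,
    ⟨not_isEllOneSequence_weakSpace, fun h => ?_⟩, fun h => ?_, fun h => ?_⟩
  · exact not_setHasWeakAFPP_positiveFace
      (h _ hne isVonNBounded_positiveFace isClosed_positiveFace convex_positiveFace)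
  · obtain ⟨k, hk, hw | hl⟩ := h EllOneWeak ellOneBasis hbdd
    · exact not_isWeaklyCauchy_ellOneBasis_comp hk hw
    · exact not_isEllOneSequence_weakSpace _ hl
  · exact not_setHasWeakAFPP_positiveFace
      (h EllOneWeak positiveFace hne isClosed_positiveFace convex_positiveFace
        isVonNBounded_positiveFace (fun x _ => not_isEllOneSequence_weakSpace x) _ subset_rfl hne
        isClosed_positiveFace convex_positiveFace)
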